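/- Let $N=2^n$ with $n\ge 0$, let $G_2=\begin{bmatrix}1&0\\1&1\end{bmatrix}$ and let $G_N=G_2^{\otimes n}$ over $\mathbb F_2$, with rows $G_N^{(0)},\dots,G_N^{(N-1)}$. Let $W$ be a binary-input memoryless channel with an arbitrary (discrete or general measurable) output alphabet $\mathcal Y$, and let $\mathcal I(W)$ denote its symmetric capacity, i.e. the mutual information between a uniform input bit and the output. For a puncturing pattern $P\in\{0,1\}^N$, a data vector $u\in\{0,1\}^N$ is encoded as $x=uG_N$; for each $j$ with $P(j)=0$ the bit $x_j$ is sent over an independent copy of $W$, which yields $y[P]_j\in\mathcal Y$, and for each $j$ with $P(j)=1$ one sets $y[P]_j=\star$, an extra erasure symbol. For $0\le i\le N-1$ let $W[P]_N^{(i)}$ be the virtual channel with input $u_i$ and output $(y[P]_0^{N-1},u_0^{i-1})$, the bits other than $u_i$ being independent and uniform. The erasure pattern $E[P]\in\{0,1\}^N$ is defined by $E[P](i)=1$ if and only if $\mathcal I(W[P]_N^{(i)})=0$. For $\mathcal L\subseteq\{0,\dots,N-1\}$ let $\bigvee_{i\in\mathcal L}G_N^{(i)}$ be the bitwise OR of the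 rows with index in $\mathcal L$ (the zero vector if $\mathcal L=\emptyset$). **Theorem.** Assume $\mathcal I(W)>0$ and let $P\in\{0,1\}^N$ be a puncturing pattern. 1. $E[P]=P$ if and only if $P$ is the zero vector or there is $\mathcal L\subseteq\{0,\dots,N-1\}$ with $P=\bigvee_{i\in\mathcal L}G_N^{(i)}$. 2. There is $\mathcal L\subseteq\{0,\dots,N-1\}$ with $E[P]=\bigvee_{i\in\mathcal L}G_N^{(i)}$. 3. $E[P]$ does not depend on $W$: every binary-input memoryless channel $W'$ with $\mathcal I(W')>0$ gives the same erasure pattern. -/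

import Mathlib

open MeasureTheory
open scoped ENNReal

noncomputable section

namespace PolarPuncturing

/-- Binary vectors of length `N`, indexed by `0, …, N - 1`. -/
abbrev BinVec (N : ℕ) : Type := Fin N → ZMod 2

/-- The kernel matrix `G₂`. -/
def kernelMatrix : Matrix (Fin 2) (Fin 2) (ZMod 2) := !![1, 0; 1, 1]

/-- The `n`-th Kronecker power `G_N = G₂^{⊗ n}`, `N = 2 ^ n`. The pair `(a, j)` of row (or column)
indices of `G₂ ⊗ G_{N/2}` is identified with the index `a * (N/2) + j`, as usual. -/
def polarMatrix : (n : ℕ) → Matrix (Fin (2 ^ n)) (Fin (2 ^ n)) (ZMod 2)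
  | 0 => 1
  | n + 1 =>
    let e : Fin 2 × Fin (2 ^ n) ≃ Fin (2 ^ (n + 1)) :=
      finProdFinEquiv.trans (finCongr (pow_succ' 2 n).symm)
    Matrix.reindex e e (Matrix.kronecker kernelMatrix (polarMatrix n))

/-- Bitwise OR of the vectors `A l`, `l ∈ L` (the zero vector if `L` is empty). -/
def bitOr {ι : Type*} {N : ℕ} (L : Finset ι) (A : ι → BinVec N) : BinVec N := by
  classical
  exact fun j => if ∃ l ∈ L, A l j = 1 then 1 else 0

/-- The law of the channel output when the input bit is uniform. -/
def outputLaw {Y : Type*} [MeasurableSpace Y] (W : ZMod 2 → Measure Y) : Measure Y :=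
  ∑ x : ZMod 2, (1 / 2 : ℝ≥0∞) • W x

/-- Symmetric capacity, in bits, of the binary-input channel whose output has law `W x` when `x` is
sent: the mutual information between a uniform input bit and the output,
`∑ₓ ½ ∫ log₂ (dW x / dM) dW x` with `M = ½ W 0 + ½ W 1`. -/
def symmetricCapacity {Y : Type*} [MeasurableSpace Y] (W : ZMod 2 → Measure Y) : ℝ≥0∞ :=
  (∑ x : ZMod 2, (1 / 2 : ℝ≥0∞) * InformationTheory.klDiv (W x) (outputLaw W))
    / ENNReal.ofReal (Real.log 2)

/-- The law of the punctured received sequence when the codeword `x` is sent through independent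
uses of `W`. The alphabet is extended by the erasure symbol `Sum.inr ()`, which is
received exactly at the punctured positions. -/
def receivedLaw {Y : Type*} [MeasurableSpace Y] (W : ZMod 2 → Measure Y) {N : ℕ}
    (P x : BinVec N) : Measure (Fin N → Y ⊕ Unit) :=
  Measure.pi fun j =>
    if P j = 1 then Measure.dirac (Sum.inr ()) else (W (x j)).map Sum.inl

/-- The virtual channel with input `u i` and output `(y[P], (u k)_{k < i})`, where the data bits
other than `u i` are uniform and `y[P]` is the punctured received sequence for the codeword
`u · G_N`. -/
def virtualChannel {Y : Type*} [MeasurableSpace Y] (W : ZMod 2 → Measure Y) {n : ℕ}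
    (P : BinVec (2 ^ n)) (i : Fin (2 ^ n)) (b : ZMod 2) :
    Measure ((Fin (2 ^ n) → Y ⊕ Unit) × ({k : Fin (2 ^ n) // k < i} → ZMod 2)) :=
  ∑ u : BinVec (2 ^ n) with u i = b,
    (1 / 2 ^ (2 ^ n - 1) : ℝ≥0∞) •
      (receivedLaw W P (Matrix.vecMul u (polarMatrix n))).map
        (fun y => (y, fun k : {k : Fin (2 ^ n) // k < i} => u k))

/-- The data bit erasure pattern `E[P]`: it marks the positions whose virtual channel has
symmetric capacity zero. -/
def erasurePattern {Y : Type*} [MeasurableSpace Y] (W : ZMod 2 → Measure Y) {n : ℕ}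
    (P : BinVec (2 ^ n)) : BinVec (2 ^ n) := by
  classical
  exact fun i => if symmetricCapacity (virtualChannel W P i) = 0 then 1 else 0

end PolarPuncturing

end

namespace PolarPuncturing

/-! Everything reduces to linear algebra over `ZMod 2`. Since h · (uG) = (Gh) · u, a vector h that
avoids the punctured positions and for which the last nonzero entry of Gh is at i expresses u i
through unpunctured code bits and earlier data bits (`Recoverable`). When W 0 ≠ W 1, such an h
yields a test statistic that separates u i = 0 from u i = 1 (`virtualChannel_ne_of_recoverable`).
Without such an h, duality yields a flip of u i and later bits that leaves the output law unchanged
(`exists_flip_of_not_recoverable`). So E[P] marks the non-recoverable indices, a condition free of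
W.

In one Kronecker step, recoverability at (0, i) is recoverability at i for the OR of the two halves
of P, and at (1, i) for their AND. By induction, erasures propagate from i to j whenever G i j = 1,
and a pattern closed under this propagation is its own erasure pattern. The relation G i j = 1 is a
preorder, so the closed patterns are exactly the ORs of rows. -/

instance subsingleton_fin_two_pow_zero : Subsingleton (Fin (2 ^ 0)) :=
  inferInstanceAs (Subsingleton (Fin 1))

/-- The identification of `(a, j)` with the index `a * 2 ^ n + j`. -/
def pairEquiv (n : ℕ) : Fin 2 × Fin (2 ^ n) ≃ Fin (2 ^ (n + 1)) :=
  finProdFinEquiv.trans (finCongr (pow_succ' 2 n).symm)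

theorem pairEquiv_val (n : ℕ) (a : Fin 2) (j : Fin (2 ^ n)) :
    (pairEquiv n (a, j) : ℕ) = j + 2 ^ n * a := by
  simp [pairEquiv, finProdFinEquiv]

theorem pairEquiv_lt_same {n : ℕ} (a : Fin 2) (j k : Fin (2 ^ n)) :
    pairEquiv n (a, j) < pairEquiv n (a, k) ↔ j < k := by
  rw [Fin.lt_def, Fin.lt_def, pairEquiv_val, pairEquiv_val]
  omega

theorem pairEquiv_zero_lt_one {n : ℕ} (j k : Fin (2 ^ n)) :
    pairEquiv n (0, j) < pairEquiv n (1, k) := by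
  have := j.2
  rw [Fin.lt_def, pairEquiv_val, pairEquiv_val]
  simp
  omega

theorem forall_pairEquiv {n : ℕ} {p : Fin (2 ^ (n + 1)) → Prop} :
    (∀ k, p k) ↔ (∀ j, p (pairEquiv n (0, j))) ∧ ∀ j, p (pairEquiv n (1, j)) := by
  rw [← (pairEquiv n).forall_congr_right]
  simp [Prod.forall, Fin.forall_fin_two]

theorem polarMatrix_succ_apply {n : ℕ} (a b : Fin 2) (j k : Fin (2 ^ n)) :
    polarMatrix (n + 1) (pairEquiv n (a, j)) (pairEquiv n (b, k)) =
      kernelMatrix a b * polarMatrix n j k := by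
  change Matrix.reindex (pairEquiv n) (pairEquiv n)
    (Matrix.kronecker kernelMatrix (polarMatrix n)) _ _ = _
  simp [Matrix.reindex_apply]

theorem polarMatrix_self (n : ℕ) (i : Fin (2 ^ n)) : polarMatrix n i i = 1 := by
  induction n with
  | zero => simp [polarMatrix]
  | succ n ih =>
    revert i
    rw [forall_pairEquiv]
    simp [polarMatrix_succ_apply, ih, kernelMatrix]

/-- The relation G i j = 1 says that the binary digits of j are dominated by those of i, because
`kernelMatrix` encodes b ≤ a. -/
theorem polarMatrix_trans (n : ℕ) (i j k : Fin (2 ^ n)) (hij : polarMatrix n i j = 1)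
    (hjk : polarMatrix n j k = 1) : polarMatrix n i k = 1 := by
  induction n with
  | zero => rw [Subsingleton.elim k i, polarMatrix_self]
  | succ n ih =>
    revert i j k
    simp only [forall_pairEquiv, polarMatrix_succ_apply]
    simp [kernelMatrix]
    aesop

/-! ### Closed patterns and ORs of rows -/

/-- The punctured set is closed under the domination order encoded by the polar matrix. -/
def IsDominated {n : ℕ} (P : BinVec (2 ^ n)) : Prop :=
  ∀ i j, P i = 1 → polarMatrix n i j = 1 → P j = 1

theorem eq_of_eq_one_iff {a b : ZMod 2} (h : a = 1 ↔ b = 1) : a = b := by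
  revert a b; decide

theorem eq_zero_of_ne_one {a : ZMod 2} (h : a ≠ 1) : a = 0 := by
  revert a; decide

theorem bitOr_eq_one_iff {ι : Type*} {N : ℕ} (L : Finset ι) (A : ι → BinVec N) (j : Fin N) :
    bitOr L A j = 1 ↔ ∃ l ∈ L, A l j = 1 := by
  unfold bitOr
  split_ifs with h <;> simp [h]

/-- A closed pattern is the OR of the rows indexed by its own support, by reflexivity and closure;
conversely, transitivity makes any OR of rows closed. -/
theorem isDominated_iff_exists_bitOr {n : ℕ} (P : BinVec (2 ^ n)) :
    IsDominated P ↔ ∃ L : Finset (Fin (2 ^ n)), P = bitOr L (fun i => (polarMatrix n).row i) := by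
  classical
  constructor
  · intro hP
    refine ⟨Finset.univ.filter (fun i => P i = 1), funext fun j => eq_of_eq_one_iff ?_⟩
    rw [bitOr_eq_one_iff]
    constructor
    · exact fun h => ⟨j, by simpa using h, polarMatrix_self n j⟩
    · rintro ⟨i, hi, hij⟩
      exact hP i j (by simpa using hi) hij
  · rintro ⟨L, rfl⟩ i j hi hij
    rw [bitOr_eq_one_iff] at hi ⊢
    obtain ⟨l, hl, hli⟩ := hi
    exact ⟨l, hl, polarMatrix_trans n l i j hli hij⟩

/-- The half of a vector selected by the leading bit `a` of the index. -/
def half {n : ℕ} (a : Fin 2) (P : BinVec (2 ^ (n + 1))) : BinVec (2 ^ n) :=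
  fun j => P (pairEquiv n (a, j))

theorem isDominated_succ_iff {n : ℕ} (P : BinVec (2 ^ (n + 1))) :
    IsDominated P ↔ IsDominated (half 0 P) ∧ IsDominated (half 1 P) ∧
      ∀ j, half 1 P j = 1 → half 0 P j = 1 := by
  have h1 := polarMatrix_self n
  simp only [IsDominated, forall_pairEquiv, polarMatrix_succ_apply, half]
  simp only [kernelMatrix, Matrix.of_apply, Matrix.cons_val', Matrix.cons_val_zero,
    Matrix.cons_val_one, Matrix.cons_val_fin_one, one_mul, zero_mul, zero_ne_one,
    false_imp_iff, imp_true_iff, and_true]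
  constructor
  · rintro ⟨h0, h⟩
    exact ⟨h0, fun i j => (h i).2 j, fun j hj => (h j).1 j hj (h1 j)⟩
  · rintro ⟨h0, h, h01⟩
    exact ⟨h0, fun i => ⟨fun j hi => h0 i j (h01 i hi), h i⟩⟩

/-! ### Recoverability and its recursion -/

/-- Some combination of the unpunctured code bits determines `u i` from the bits before it. -/
def Recoverable {n : ℕ} (P : BinVec (2 ^ n)) (i : Fin (2 ^ n)) : Prop :=
  ∃ h : BinVec (2 ^ n), (∀ j, P j = 1 → h j = 0) ∧
    (∀ k, i < k → (polarMatrix n).mulVec h k = 0) ∧ (polarMatrix n).mulVec h i = 1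

theorem Recoverable.mono {n : ℕ} {P Q : BinVec (2 ^ n)} (hPQ : ∀ j, P j = 1 → Q j = 1)
    {i : Fin (2 ^ n)} (h : Recoverable Q i) : Recoverable P i := by
  obtain ⟨h, h1, h2⟩ := h
  exact ⟨h, fun j hj => h1 j (hPQ j hj), h2⟩

theorem mulVec_half_zero {n : ℕ} (h : BinVec (2 ^ (n + 1))) (k : Fin (2 ^ n)) :
    (polarMatrix (n + 1)).mulVec h (pairEquiv n (0, k)) = (polarMatrix n).mulVec (half 0 h) k := by
  simp only [Matrix.mulVec, dotProduct]
  rw [← (pairEquiv n).sum_comp, Fintype.sum_prod_type]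
  simp [polarMatrix_succ_apply, kernelMatrix, half]

theorem mulVec_half_one {n : ℕ} (h : BinVec (2 ^ (n + 1))) (k : Fin (2 ^ n)) :
    (polarMatrix (n + 1)).mulVec h (pairEquiv n (1, k)) =
      (polarMatrix n).mulVec (half 0 h + half 1 h) k := by
  simp only [Matrix.mulVec, dotProduct]
  rw [← (pairEquiv n).sum_comp, Fintype.sum_prod_type]
  simp [polarMatrix_succ_apply, kernelMatrix, half, mul_add, Finset.sum_add_distrib]

/-- The vector with halves `v 0` and `v 1`. -/
def join {n : ℕ} (v : Fin 2 → BinVec (2 ^ n)) : BinVec (2 ^ (n + 1)) :=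
  fun k => v ((pairEquiv n).symm k).1 ((pairEquiv n).symm k).2

theorem half_join {n : ℕ} (a : Fin 2) (v : Fin 2 → BinVec (2 ^ n)) : half a (join v) = v a := by
  ext; simp [half, join]

/-- The kernel is an involution in characteristic 2, hence so are its Kronecker powers. This serves
as injectivity of G. -/
theorem polarMatrix_mulVec_self (n : ℕ) (h : BinVec (2 ^ n)) :
    (polarMatrix n).mulVec ((polarMatrix n).mulVec h) = h := by
  induction n with
  | zero => simp [polarMatrix]
  | succ n ih =>
    funext k
    revert k
    have e0 : half 0 ((polarMatrix (n + 1)).mulVec h) = (polarMatrix n).mulVec (half 0 h) :=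
      funext (mulVec_half_zero h)
    have e1 : half 1 ((polarMatrix (n + 1)).mulVec h) =
        (polarMatrix n).mulVec (half 0 h + half 1 h) := funext (mulVec_half_one h)
    rw [forall_pairEquiv]
    refine ⟨fun j => ?_, fun j => ?_⟩
    · rw [mulVec_half_zero, e0, ih]; rfl
    · rw [mulVec_half_one, e0, e1, ← Matrix.mulVec_add, ih, ← add_assoc, CharTwo.add_self_eq_zero,
        zero_add]
      rfl

/-- Only the sum of the halves of h matters here, and position j of that sum is forced to vanish
only when both copies of j are punctured. -/
theorem recoverable_one_iff {n : ℕ} (P : BinVec (2 ^ (n + 1))) (i : Fin (2 ^ n)) :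
    Recoverable P (pairEquiv n (1, i)) ↔ Recoverable (half 0 P * half 1 P) i := by
  constructor
  · rintro ⟨h, hP, hlt, hi⟩
    refine ⟨half 0 h + half 1 h, fun j hj => ?_, fun k hk => ?_, ?_⟩
    · have hj' : P (pairEquiv n (0, j)) * P (pairEquiv n (1, j)) = 1 := hj
      have : P (pairEquiv n (0, j)) = 1 ∧ P (pairEquiv n (1, j)) = 1 := by
        revert hj'
        generalize P (pairEquiv n (0, j)) = a
        generalize P (pairEquiv n (1, j)) = b
        revert a b; decide
      simp [half, hP _ this.1, hP _ this.2]
    · rw [← mulVec_half_one]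
      exact hlt _ ((pairEquiv_lt_same 1 i k).2 hk)
    · rwa [← mulVec_half_one]
  · rintro ⟨h, hP, hlt, hi⟩
    -- Each entry of h is placed in half 0 unless that copy is punctured, and otherwise in half 1.
    refine ⟨join ![fun j => if half 0 P j = 1 then 0 else h j,
      fun j => if half 0 P j = 1 then h j else 0], ?_, ?_, ?_⟩
    · rw [forall_pairEquiv]
      refine ⟨fun j hj => ?_, fun j hj => ?_⟩
      · simp [join, half, hj]
      · by_cases h0 : P (pairEquiv n (0, j)) = 1
        · simp [join, half, h0, hP j (by simp [half, h0, hj])]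
        · simp [join, half, h0]
    all_goals
      have e : (fun j => if half 0 P j = 1 then 0 else h j) +
        (fun j => if half 0 P j = 1 then h j else 0) = h := by
        ext j; by_cases h0 : half 0 P j = 1 <;> simp [h0]
    · rw [forall_pairEquiv]
      refine ⟨fun j hj => absurd hj (pairEquiv_zero_lt_one j i).not_gt, fun j hj => ?_⟩
      rw [mulVec_half_one, half_join, half_join]
      simpa [e] using hlt j ((pairEquiv_lt_same 1 i j).1 hj)
    · rw [mulVec_half_one, half_join, half_join]
      simpa [e] using hi

/-- All indices (1, k) come after (0, i), so G must kill the sum of the halves of h. The halves then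
coincide and avoid the punctures of both; a + b + ab is OR over `ZMod 2`. -/
theorem recoverable_zero_iff {n : ℕ} (P : BinVec (2 ^ (n + 1))) (i : Fin (2 ^ n)) :
    Recoverable P (pairEquiv n (0, i)) ↔
      Recoverable (half 0 P + half 1 P + half 0 P * half 1 P) i := by
  have or_iff : ∀ a b : ZMod 2, a + b + a * b = 1 ↔ a = 1 ∨ b = 1 := by decide
  constructor
  · rintro ⟨h, hP, hlt, hi⟩
    have hs : half 0 h + half 1 h = 0 := by
      rw [← polarMatrix_mulVec_self n (half 0 h + half 1 h)]
      have : (polarMatrix n).mulVec (half 0 h + half 1 h) = 0 := funext fun k => by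
        rw [← mulVec_half_one]
        exact hlt _ (pairEquiv_zero_lt_one i k)
      rw [this, Matrix.mulVec_zero]
    have hs' : half 0 h = half 1 h := CharTwo.add_eq_zero.1 hs
    refine ⟨half 0 h, fun j hj => ?_, fun k hk => ?_, ?_⟩
    · rcases (or_iff _ _).1 hj with hj | hj
      · exact hP _ hj
      · rw [hs']; exact hP _ hj
    · rw [← mulVec_half_zero]
      exact hlt _ ((pairEquiv_lt_same 0 i k).2 hk)
    · rwa [← mulVec_half_zero]
  · rintro ⟨h, hP, hlt, hi⟩
    refine ⟨join fun _ => h, ?_, ?_, ?_⟩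
    · rw [forall_pairEquiv]
      refine ⟨fun j hj => ?_, fun j hj => ?_⟩
      · simpa [join] using hP j ((or_iff _ _).2 (Or.inl hj))
      · simpa [join] using hP j ((or_iff _ _).2 (Or.inr hj))
    · rw [forall_pairEquiv]
      refine ⟨fun j hj => ?_, fun j _ => ?_⟩
      · rw [mulVec_half_zero, half_join]
        exact hlt j ((pairEquiv_lt_same 0 i j).1 hj)
      · rw [mulVec_half_one, half_join, half_join, CharTwo.add_self_eq_zero, Matrix.mulVec_zero]
        rfl
    · rw [mulVec_half_zero, half_join]
      exact hi

/-- The only case that mixes halves passes from the OR pattern to the AND pattern, which punctures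
less. -/
theorem Recoverable.of_polarMatrix_eq_one {n : ℕ} {P : BinVec (2 ^ n)} {i j : Fin (2 ^ n)}
    (hj : Recoverable P j) (hij : polarMatrix n i j = 1) : Recoverable P i := by
  induction n with
  | zero => rwa [Subsingleton.elim i j]
  | succ n ih =>
    revert i j
    simp only [forall_pairEquiv, polarMatrix_succ_apply, recoverable_zero_iff, recoverable_one_iff]
    simp only [kernelMatrix, Matrix.of_apply, Matrix.cons_val', Matrix.cons_val_zero,
      Matrix.cons_val_one, Matrix.cons_val_fin_one, one_mul, zero_mul, zero_ne_one,
      false_imp_iff, imp_true_iff, and_true]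
    refine ⟨fun i j hj hij => ih hj hij,
      fun i => ⟨fun j hj hij => ih (hj.mono fun k => ?_) hij, fun j hj hij => ih hj hij⟩⟩
    simp only [Pi.add_apply, Pi.mul_apply]
    generalize half 0 P k = a
    generalize half 1 P k = b
    revert a b; decide

/-- Closure nests the halves, so their OR is half 0 and their AND is half 1: the recursion leaves
the pattern in place. -/
theorem IsDominated.recoverable_iff {n : ℕ} {P : BinVec (2 ^ n)} (hP : IsDominated P)
    (i : Fin (2 ^ n)) : Recoverable P i ↔ P i ≠ 1 := by
  induction n with
  | zero =>
    constructor
    · rintro ⟨h, hP, -, hi⟩ h1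
      simp [polarMatrix, hP i h1] at hi
    · intro h1
      refine ⟨fun _ => 1, fun j hj => ?_, fun k hk => ?_, by simp [polarMatrix]⟩
      · exact absurd (Subsingleton.elim i j ▸ hj) h1
      · exact absurd (Subsingleton.elim i k) hk.ne
  | succ n ih =>
    rw [isDominated_succ_iff] at hP
    obtain ⟨h0, h1, h10⟩ := hP
    have eAnd : half 0 P * half 1 P = half 1 P := funext fun k => by
      have := h10 k
      revert this
      simp only [Pi.mul_apply]
      generalize half 0 P k = a
      generalize half 1 P k = b
      revert a b; decide
    revert i
    rw [forall_pairEquiv]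
    refine ⟨fun i => ?_, fun i => ?_⟩
    · rw [recoverable_zero_iff, eAnd, add_assoc, CharTwo.add_self_eq_zero, add_zero, ih h0]
      rfl
    · rw [recoverable_one_iff, eAnd, ih h1]
      rfl

end PolarPuncturing

/-! ### Undetectable flips -/

namespace PolarPuncturing

/-- If `u i` cannot be recovered, some flip of `u i` and of later bits leaves the received bits
unchanged. -/
theorem exists_flip_of_not_recoverable {n : ℕ} {P : BinVec (2 ^ n)} {i : Fin (2 ^ n)}
    (h : ¬ Recoverable P i) :
    ∃ w : BinVec (2 ^ n), (∀ k, k < i → w k = 0) ∧ w i = 1 ∧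
      ∀ j, P j ≠ 1 → Matrix.vecMul w (polarMatrix n) j = 0 := by
  classical
  let r : Fin (2 ^ n) → BinVec (2 ^ n) := fun k j => if P j = 1 then 0 else polarMatrix n k j
  -- Otherwise a functional f kills the later punctured rows but not row i, and its coordinates off
  -- P form an h making i recoverable.
  have hmem : r i ∈ Submodule.span (ZMod 2) (r '' Set.Ioi i) := by
    by_contra hni
    obtain ⟨f, hf, hf0⟩ := Submodule.exists_dual_map_eq_bot_of_notMem hni inferInstance
    have key : ∀ k, (polarMatrix n).mulVec
        (fun j => if P j = 1 then 0 else f (Pi.single j 1)) k = f (r k) := fun k => by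
      rw [LinearMap.pi_apply_eq_sum_univ f (r k)]
      simp only [Matrix.mulVec, dotProduct, r]
      refine Finset.sum_congr rfl fun j _ => ?_
      have : (fun l => if j = l then (1 : ZMod 2) else 0) = Pi.single j 1 := by
        ext l; simp [Pi.single_apply, eq_comm]
      rw [this]
      split_ifs <;> simp
    refine h ⟨fun j => if P j = 1 then 0 else f (Pi.single j 1), fun j hj => if_pos hj,
      fun k hk => ?_, ?_⟩
    · rw [key, ← Submodule.mem_bot (ZMod 2), ← hf0]
      exact Submodule.mem_map_of_mem (Submodule.subset_span ⟨k, hk, rfl⟩)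
    · rw [key]
      by_contra h1
      exact hf (eq_zero_of_ne_one h1)
  obtain ⟨l, hl, hx⟩ := (Finsupp.mem_span_image_iff_linearCombination (ZMod 2)).1 hmem
  have hl' : ∀ k, k ≤ i → l k = 0 := fun k hk => by
    by_contra hne
    exact absurd (hl (Finsupp.mem_support_iff.2 hne)) (not_lt.2 hk)
  -- The flip is e_i plus the coefficients that express row i, off P, through later rows.
  refine ⟨fun k => l k + if k = i then 1 else 0, fun k hk => ?_, ?_, fun j hj => ?_⟩
  · simp [hl' k hk.le, hk.ne]
  · simp [hl' i le_rfl]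
  · have := congrFun hx j
    rw [Finsupp.linearCombination_apply, Finsupp.sum_fintype _ _ (by simp)] at this
    simp only [Finset.sum_apply, Pi.smul_apply, smul_eq_mul, r, if_neg hj] at this
    simp only [Matrix.vecMul, dotProduct, add_mul, Finset.sum_add_distrib, this]
    simp [CharTwo.add_self_eq_zero]

/-! ### Zero capacity as equality of output laws -/

section Capacity

variable {Y : Type*} [MeasurableSpace Y]

/-- Both divergences from the mean law must vanish, and divergence vanishes only between equal
measures. -/
theorem symmetricCapacity_eq_zero_iff (V : ZMod 2 → Measure Y) [∀ x, IsFiniteMeasure (V x)] :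
    symmetricCapacity V = 0 ↔ V 0 = V 1 := by
  have hM : outputLaw V = (1 / 2 : ℝ≥0∞) • V 0 + (1 / 2 : ℝ≥0∞) • V 1 := Fin.sum_univ_two _
  have : IsFiniteMeasure (outputLaw V) := by
    have h : ∀ x, IsFiniteMeasure ((1 / 2 : ℝ≥0∞) • V x) := fun x =>
      Measure.smul_finite _ (by simp)
    rw [hM]
    have := h 0
    have := h 1
    infer_instance
  have hs : symmetricCapacity V = 0 ↔ V 0 = outputLaw V ∧ V 1 = outputLaw V := by
    unfold symmetricCapacity
    rw [ENNReal.div_eq_zero_iff, or_iff_left ENNReal.ofReal_ne_top,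
      show (∑ x : ZMod 2, (1 / 2 : ℝ≥0∞) * InformationTheory.klDiv (V x) (outputLaw V)) =
        1 / 2 * InformationTheory.klDiv (V 0) (outputLaw V) +
          1 / 2 * InformationTheory.klDiv (V 1) (outputLaw V) from Fin.sum_univ_two _]
    simp [InformationTheory.klDiv_eq_zero_iff]
  rw [hs]
  constructor
  · rintro ⟨h0, h1⟩
    rw [h0, ← h1]
  · intro h
    have : outputLaw V = V 1 := by
      rw [hM, h, ← add_smul, ENNReal.add_halves, one_smul]
    rw [this]
    exact ⟨h, rfl⟩

variable (W : ZMod 2 → Measure Y)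

/-- The law of a single received symbol. -/
noncomputable def symbolLaw (p x : ZMod 2) : Measure (Y ⊕ Unit) :=
  if p = 1 then Measure.dirac (Sum.inr ()) else (W x).map Sum.inl

theorem receivedLaw_eq {N : ℕ} (P x : BinVec N) :
    receivedLaw W P x = Measure.pi fun j => symbolLaw W (P j) (x j) := rfl

theorem receivedLaw_congr {N : ℕ} {P x x' : BinVec N} (h : ∀ j, P j ≠ 1 → x j = x' j) :
    receivedLaw W P x = receivedLaw W P x' := by
  unfold receivedLaw
  congr 1
  funext j
  split_ifs with hj
  · rfl
  · rw [h j hj]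

theorem virtualChannel_eq_of_not_recoverable {n : ℕ} {P : BinVec (2 ^ n)} {i : Fin (2 ^ n)}
    (h : ¬ Recoverable P i) : virtualChannel W P i 0 = virtualChannel W P i 1 := by
  obtain ⟨w, hlt, hi, hP⟩ := exists_flip_of_not_recoverable h
  unfold virtualChannel
  have hw : ∀ u : BinVec (2 ^ n), u + w + w = u := fun u => by
    rw [add_assoc, CharTwo.add_self_eq_zero, add_zero]
  -- Translation by the flip w is an involution exchanging the terms with u i = 0 and u i = 1; it
  -- preserves the earlier bits and the received law.
  refine Finset.sum_bij' (fun u _ => u + w) (fun u _ => u + w) ?_ ?_ (fun u _ => hw u)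
    (fun u _ => hw u) fun u _ => ?_
  · intro u hu
    simp only [Finset.mem_filter, Finset.mem_univ, true_and] at hu
    simp [hu, hi]
  · intro u hu
    simp only [Finset.mem_filter, Finset.mem_univ, true_and] at hu
    simp [hu, hi, CharTwo.add_self_eq_zero]
  · have e : (fun k : {k : Fin (2 ^ n) // k < i} => (u + w) k) =
        fun k : {k : Fin (2 ^ n) // k < i} => u k := by
      funext k
      simp [hlt k k.2]
    rw [e, receivedLaw_congr W (x := Matrix.vecMul (u + w) (polarMatrix n)) fun j hj => ?_]
    rw [Matrix.add_vecMul, Pi.add_apply, hP j hj, add_zero]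

/-! ### Parity tests on the received word -/

/-- The sign `(-1) ^ b`. -/
noncomputable def sign (b : ZMod 2) : ℝ := if b = 1 then -1 else 1

theorem sign_add (a b : ZMod 2) : sign (a + b) = sign a * sign b := by
  have h : ∀ a b : ZMod 2, (a + b = 1 ↔ (a = 1 ↔ b ≠ 1)) := by decide
  unfold sign
  by_cases ha : a = 1 <;> by_cases hb : b = 1 <;> simp [h, ha, hb]

theorem sign_sum {ι : Type*} (s : Finset ι) (f : ι → ZMod 2) :
    sign (∑ j ∈ s, f j) = ∏ j ∈ s, sign (f j) := by
  classical
  induction s using Finset.induction_on with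
  | empty => simp [sign]
  | insert a s ha ih => rw [Finset.sum_insert ha, Finset.prod_insert ha, sign_add, ih]

/-- The indicator of `A`, centred at the average of its two conditional probabilities. -/
noncomputable def centredIndicator (A : Set Y) : Y ⊕ Unit → ℝ :=
  Sum.elim (fun y => A.indicator 1 y - ((W 0).real A + (W 1).real A) / 2) 0

/-- A test function on the received symbol that correlates with the code bit when `h = 1`. -/
noncomputable def symbolTest (A : Set Y) (h : ZMod 2) : Y ⊕ Unit → ℝ :=
  if h = 1 then centredIndicator W A else 1

theorem measurable_symbolTest {A : Set Y} (hA : MeasurableSet A) (h : ZMod 2) :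
    Measurable (symbolTest W A h) := by
  unfold symbolTest
  split_ifs
  · exact Measurable.sumElim ((measurable_one.indicator hA).sub_const _) measurable_zero
  · exact measurable_one

variable [∀ x, IsProbabilityMeasure (W x)]

instance isProbabilityMeasure_symbolLaw (p x : ZMod 2) :
    IsProbabilityMeasure (symbolLaw W p x) := by
  unfold symbolLaw
  split_ifs
  · infer_instance
  · exact Measure.isProbabilityMeasure_map measurable_inl.aemeasurable

instance isProbabilityMeasure_receivedLaw {N : ℕ} (P x : BinVec N) :
    IsProbabilityMeasure (receivedLaw W P x) := by
  rw [receivedLaw_eq]; infer_instance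

instance isFiniteMeasure_virtualChannel {n : ℕ} (P : BinVec (2 ^ n)) (i : Fin (2 ^ n))
    (b : ZMod 2) : IsFiniteMeasure (virtualChannel W P i b) := by
  unfold virtualChannel
  have h : ∀ u : BinVec (2 ^ n), IsFiniteMeasure ((1 / 2 ^ (2 ^ n - 1) : ℝ≥0∞) •
      (receivedLaw W P (Matrix.vecMul u (polarMatrix n))).map
        (fun y => (y, fun k : {k : Fin (2 ^ n) // k < i} => u k))) := fun u =>
    Measure.smul_finite _ (by simp)
  infer_instance

theorem abs_symbolTest_le (A : Set Y) (h : ZMod 2) (z : Y ⊕ Unit) :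
    |symbolTest W A h z| ≤ 1 := by
  have h0 := measureReal_nonneg (μ := W 0) (s := A)
  have h1 := measureReal_nonneg (μ := W 1) (s := A)
  have h0' := measureReal_le_one (μ := W 0) (s := A)
  have h1' := measureReal_le_one (μ := W 1) (s := A)
  unfold symbolTest
  split_ifs
  · rcases z with y | z
    · by_cases hy : y ∈ A <;> simp only [centredIndicator, Sum.elim_inl, hy, Set.indicator_of_mem,
        Set.indicator_of_notMem, not_false_eq_true, Pi.one_apply] <;> rw [abs_le] <;> constructor <;> linarith
    · simp [centredIndicator]
  · simp

/-- Centring makes the means for the two inputs opposite, so the code bit enters only through a sign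
and products of tests compute parities. The hypothesis `hp` keeps the test off erased symbols. -/
theorem integral_symbolTest {A : Set Y} (hA : MeasurableSet A) {p h : ZMod 2}
    (hp : p = 1 → h = 0) (x : ZMod 2) :
    ∫ z, symbolTest W A h z ∂(symbolLaw W p x) =
      (if h = 1 then ((W 0).real A - (W 1).real A) / 2 else 1) * sign (h * x) := by
  by_cases hh : h = 1
  · have hp1 : p ≠ 1 := fun h1 => by simp [hp h1] at hh
    rw [symbolLaw, if_neg hp1, integral_map measurable_inl.aemeasurable
      (measurable_symbolTest W hA h).aestronglyMeasurable]
    simp only [symbolTest, if_pos hh, centredIndicator, Sum.elim_inl]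
    have hint : Integrable (A.indicator (1 : Y → ℝ)) (W x) :=
      (integrable_const (1 : ℝ)).indicator hA
    rw [integral_sub hint (integrable_const _), integral_indicator_one hA, integral_const]
    subst hh
    have hx : x = 0 ∨ x = 1 := by clear hint; revert x; decide
    rcases hx with rfl | rfl <;> simp [sign] <;> ring
  · simp [symbolTest, eq_zero_of_ne_one hh, sign]

theorem integral_prod_symbolTest {A : Set Y} (hA : MeasurableSet A) {N : ℕ} {P h : BinVec N}
    (hP : ∀ j, P j = 1 → h j = 0) (x : BinVec N) :
    ∫ y, ∏ j, symbolTest W A (h j) (y j) ∂(receivedLaw W P x) =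
      (∏ j, if h j = 1 then ((W 0).real A - (W 1).real A) / 2 else 1) * sign (dotProduct h x) := by
  rw [receivedLaw_eq, integral_fintype_prod_eq_prod (fun j => symbolTest W A (h j)), dotProduct,
    sign_sum, ← Finset.prod_mul_distrib]
  exact Finset.prod_congr rfl fun j _ => integral_symbolTest W hA (hP j) (x j)

theorem virtualChannel_ne_of_recoverable (hW : W 0 ≠ W 1) {n : ℕ} {P : BinVec (2 ^ n)}
    {i : Fin (2 ^ n)} (hr : Recoverable P i) :
    virtualChannel W P i 0 ≠ virtualChannel W P i 1 := by
  classical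
  obtain ⟨h, hP, hlt, hi⟩ := hr
  obtain ⟨A, hA, hne⟩ : ∃ A, MeasurableSet A ∧ W 0 A ≠ W 1 A := by
    by_contra! hc
    exact hW (Measure.ext hc)
  set d : ℝ := ∏ j, if h j = 1 then ((W 0).real A - (W 1).real A) / 2 else 1 with hd
  have hd0 : d ≠ 0 := by
    refine Finset.prod_ne_zero_iff.2 fun j _ => ?_
    split_ifs
    · have : (W 0).real A ≠ (W 1).real A := fun e =>
        hne ((ENNReal.toReal_eq_toReal_iff' (measure_ne_top _ _) (measure_ne_top _ _)).1 e)
      exact div_ne_zero (sub_ne_zero.2 this) two_ne_zero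
    · exact one_ne_zero
  -- Restricting to an all-zero past removes the contribution of earlier bits to the parity.
  let F : (Fin (2 ^ n) → Y ⊕ Unit) × ({k : Fin (2 ^ n) // k < i} → ZMod 2) → ℝ :=
    fun z => (∏ j, symbolTest W A (h j) (z.1 j)) * if z.2 = 0 then 1 else 0
  have hFm : Measurable F := by
    refine Measurable.mul ?_ ?_
    · exact Finset.measurable_fun_prod _ fun j _ =>
        (measurable_symbolTest W hA _).comp ((measurable_pi_apply j).comp measurable_fst)
    · exact (Measurable.of_discrete (f := fun t : {k : Fin (2 ^ n) // k < i} → ZMod 2 =>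
        if t = 0 then (1 : ℝ) else 0)).comp measurable_snd
  have hFb : ∀ z, ‖F z‖ ≤ 1 := fun z => by
    rw [Real.norm_eq_abs, abs_mul, Finset.abs_prod]
    refine mul_le_one₀ (Finset.prod_le_one (fun _ _ => abs_nonneg _)
      fun j _ => abs_symbolTest_le W A _ _) (abs_nonneg _) ?_
    split_ifs <;> simp
  set c : ℝ≥0∞ := 1 / 2 ^ (2 ^ n - 1) with hc
  have hctop : c ≠ ∞ := by simp [hc]
  have hc0 : 0 < c.toReal := ENNReal.toReal_pos (by simp [hc]) hctop
  have hint : ∀ b, ∫ z, F z ∂(virtualChannel W P i b) = sign b * d *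
      ∑ u : BinVec (2 ^ n) with u i = b,
        c.toReal * if (fun k : {k : Fin (2 ^ n) // k < i} => u k) = 0 then 1 else 0 := by
    intro b
    have hfin : ∀ u : BinVec (2 ^ n), IsFiniteMeasure (c •
        (receivedLaw W P (Matrix.vecMul u (polarMatrix n))).map
          (fun y => (y, fun k : {k : Fin (2 ^ n) // k < i} => u k))) := fun u =>
      Measure.smul_finite _ hctop
    unfold virtualChannel
    rw [integral_finsetSum_measure fun u _ =>
      Integrable.of_bound hFm.aestronglyMeasurable 1 (ae_of_all _ hFb), Finset.mul_sum]
    refine Finset.sum_congr rfl fun u hu => ?_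
    replace hu : u i = b := by simpa using hu
    rw [integral_smul_measure, integral_map (by fun_prop) hFm.aestronglyMeasurable]
    have hF : (fun y => F (y, fun k : {k : Fin (2 ^ n) // k < i} => u k)) = fun y =>
        (∏ j, symbolTest W A (h j) (y j)) *
          if (fun k : {k : Fin (2 ^ n) // k < i} => u k) = 0 then 1 else 0 := rfl
    rw [hF, integral_mul_const, integral_prod_symbolTest W hA hP, ← hd, ← hc, smul_eq_mul]
    split_ifs with hu0
    -- The parity is (Gh) · u: earlier terms vanish through u, later ones through Gh, leaving u i.
    · have hdot : dotProduct h (Matrix.vecMul u (polarMatrix n)) = b := by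
        rw [dotProduct_comm, ← Matrix.dotProduct_mulVec, dotProduct,
          Finset.sum_eq_single i (fun k _ hk => ?_) (by simp), hi, mul_one, hu]
        rcases lt_or_gt_of_ne hk with hk | hk
        · rw [show u k = 0 from congrFun hu0 ⟨k, hk⟩, zero_mul]
        · rw [hlt k hk, mul_zero]
      rw [hdot]; ring
    · simp
  have hnonneg : ∀ b, 0 ≤ ∑ u : BinVec (2 ^ n) with u i = b,
      c.toReal * if (fun k : {k : Fin (2 ^ n) // k < i} => u k) = 0 then (1 : ℝ) else 0 :=
    fun b => Finset.sum_nonneg fun u _ => mul_nonneg hc0.le (by split_ifs <;> simp)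
  have hpos : 0 < ∑ u : BinVec (2 ^ n) with u i = 0,
      c.toReal * if (fun k : {k : Fin (2 ^ n) // k < i} => u k) = 0 then (1 : ℝ) else 0 := by
    refine Finset.sum_pos' (fun u _ => mul_nonneg hc0.le (by split_ifs <;> simp))
      ⟨0, by simp, ?_⟩
    rw [if_pos (by ext; simp), mul_one]
    exact hc0
  -- Equal laws would force d times a positive mass to equal -d times a nonnegative one, although d
  -- ≠ 0.
  intro heq
  have key := hint 0
  rw [heq, hint 1] at key
  have s0 : sign 0 = 1 := by simp [sign]
  have s1 : sign 1 = -1 := by simp [sign]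
  rw [s0, s1, mul_assoc, mul_assoc, mul_left_comm, mul_left_comm 1] at key
  have := mul_left_cancel₀ hd0 key
  linarith [hnonneg 1]

/-! ### The erasure pattern -/

theorem erasurePattern_eq_one_iff (hW : 0 < symmetricCapacity W) {n : ℕ} (P : BinVec (2 ^ n))
    (i : Fin (2 ^ n)) : erasurePattern W P i = 1 ↔ ¬ Recoverable P i := by
  have hne : W 0 ≠ W 1 := fun h => hW.ne' ((symmetricCapacity_eq_zero_iff W).2 h)
  have : erasurePattern W P i = 1 ↔ symmetricCapacity (virtualChannel W P i) = 0 := by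
    unfold erasurePattern
    split_ifs with h <;> simp [h]
  rw [this, symmetricCapacity_eq_zero_iff]
  exact ⟨fun h hr => virtualChannel_ne_of_recoverable W hne hr h,
    virtualChannel_eq_of_not_recoverable W⟩

theorem isDominated_erasurePattern (hW : 0 < symmetricCapacity W) {n : ℕ} (P : BinVec (2 ^ n)) :
    IsDominated (erasurePattern W P) := by
  intro i j hi hij
  rw [erasurePattern_eq_one_iff W hW] at hi ⊢
  exact fun hj => hi (hj.of_polarMatrix_eq_one hij)

theorem erasurePattern_eq_self_iff (hW : 0 < symmetricCapacity W) {n : ℕ} (P : BinVec (2 ^ n)) :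
    erasurePattern W P = P ↔ IsDominated P := by
  constructor
  · intro h
    rw [← h]
    exact isDominated_erasurePattern W hW P
  · intro h
    funext i
    refine eq_of_eq_one_iff ?_
    rw [erasurePattern_eq_one_iff W hW, h.recoverable_iff, not_not]

end Capacity

end PolarPuncturing

theorem mainTheorem1 (n : ℕ) (P : PolarPuncturing.BinVec (2 ^ n))
    {Y : Type*} [MeasurableSpace Y] (W : ZMod 2 → MeasureTheory.Measure Y)
    [∀ x, MeasureTheory.IsProbabilityMeasure (W x)]
    (hW : 0 < PolarPuncturing.symmetricCapacity W) :
    (PolarPuncturing.erasurePattern W P = P ↔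
      P = 0 ∨ ∃ L : Finset (Fin (2 ^ n)),
        P = PolarPuncturing.bitOr L (fun i => (PolarPuncturing.polarMatrix n).row i)) ∧
    (∃ L : Finset (Fin (2 ^ n)),
      PolarPuncturing.erasurePattern W P =
        PolarPuncturing.bitOr L (fun i => (PolarPuncturing.polarMatrix n).row i)) ∧
    (∀ {Y' : Type*} [MeasurableSpace Y'] (W' : ZMod 2 → MeasureTheory.Measure Y')
      [∀ x, MeasureTheory.IsProbabilityMeasure (W' x)],
      0 < PolarPuncturing.symmetricCapacity W' →
        PolarPuncturing.erasurePattern W' P = PolarPuncturing.erasurePattern W P) := by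
  open PolarPuncturing in
  refine ⟨?_, (isDominated_iff_exists_bitOr _).1 (isDominated_erasurePattern W hW P), ?_⟩
  · rw [erasurePattern_eq_self_iff W hW, isDominated_iff_exists_bitOr]
    refine ⟨Or.inr, ?_⟩
    rintro (rfl | h)
    -- The zero pattern is the OR of the empty family, so the first disjunct adds nothing.
    · exact ⟨∅, by ext j; simp [bitOr]⟩
    · exact h
  · intro Y' _ W' _ hW'
    funext i
    refine eq_of_eq_one_iff ?_
    rw [erasurePattern_eq_one_iff W' hW', erasurePattern_eq_one_iff W hW]
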